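/- **Theorem 2.2.** Let $(Z_i)_{i\ge 0}$ be i.i.d. $\mathbb{R}^d$-valued random variables, let $(\mathcal X,\rho)$ be a metric space, let $\mathbf f:\mathcal X\to\mathbb R^{m\times d}$ be continuous, and let $x_i^n\in\mathcal X$ ($1\le i\le n$, $n\ge 1$) be a deterministic array. For each $n$ let $C_n$ be a subfamily of $x_1^n,\dots,x_n^n$ (an indexed family: points are counted with multiplicity, so "$x_i^n\in C_n$" selects a set of indices $i\in\{1,\dots,n\}$ and $\mathrm{card}(C_n)$ is the number of these indices), and put $C_n^{\mathbf f}=\{\mathbf f(x_i^n): x_i^n\in C_n\}\subset\mathbb R^{m\times d}$. A sequence of Borel probability measures $\mu_n$ on $\mathbb R^k$ satisfies the LDP with good rate function $J:\mathbb R^k\to[0,\infty]$ if $J$ is lower semicontinuous, the sets $\{J\le a\}$, $a\in\mathbb{R}$, are compact, and $$\limsup_{n\to\infty}\tfrac1n\log\mu_n(F)\le-\inf_F J\ \ (F\text{ closed}),\qquad -\inf_G J\le\liminf_{n\to\infty}\tfrac1n\log\mu_n(G)\ \ (G\text{ open});$$ random variables satisfy the LDP if their laws do. For $A\subset\mathbb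 R^k$ let $\Delta^*(y\mid A)=\sup_{\theta\in A}\langle y,\theta\rangle$. Let $\mathcal D_Z=\{\theta\in\mathbb R^d:\log\mathbb E\,e^{\langle\theta,Z_1\rangle}<\infty\}$ and, for $\mathbf y\in\mathbb R^{m\times d}$, $\mathcal D_{\mathbf y}=\{\lambda\in\mathbb R^m:\log\mathbb E\,e^{\langle\lambda,\mathbf y\cdot Z_1\rangle}<\infty\}$. For sets $D_n\subset\mathbb R^{m\times d}$, the outer limit $D_{\infty,\mathrm{out}}$ is the set of limits of sequences $\mathbf x_{\phi(n)}\in D_{\phi(n)}$ with $\phi:\mathbb N\to\mathbb N$ strictly increasing, and the inner limit $D_{\infty,\mathrm{in}}$ is the set of limits of sequences $(\mathbf x_n)$ with $\mathbf x_n\in D_n$ for all large $n$. An intersection over an empty index set is the whole space. Assume: * $\mathrm{card}(C_n)/n\to0$; * (A-1) $\mathbb E\,e^{\alpha|Z_1|}<\infty$ for some $\alpha>0$, and $Z_1/n$ satisfies the LDP with a good rate function $I$; * (A-2) $I=\Delta^*(\cdot\mid\mathcal D_Z)$; * (A-3) the sets $C_n^{\mathbf f}$, $n\ge1$, are non-empty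 and all contained in one compact set $K\subset\mathbb R^{m\times d}$; * (A-4) $\displaystyle\bigcap_{\mathbf y\in C^{\mathbf f}_{\infty,\mathrm{in}}}\mathcal D_{\mathbf y}=\bigcap_{\mathbf y\in C^{\mathbf f}_{\infty,\mathrm{out}}}\mathcal D_{\mathbf y}$. Then $\displaystyle\pi_n=\frac1n\sum_{x_i^n\in C_n}\mathbf f(x_i^n)\cdot Z_i$ satisfies the LDP in $(\mathbb R^m,\mathcal B(\mathbb R^m))$ with good rate function $$\Delta^*(z\mid\mathcal D)=\sup\{\langle\lambda,z\rangle:\lambda\in\mathcal D\},\qquad\text{where}\quad \mathcal D=\bigcap_{\mathbf y\in C^{\mathbf f}_{\infty,\mathrm{in}}}\mathcal D_{\mathbf y}=\bigcap_{\mathbf y\in C^{\mathbf f}_{\infty,\mathrm{out}}}\mathcal D_{\mathbf y}.$$ -/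

import Mathlib

open MeasureTheory ProbabilityTheory Filter Topology

noncomputable section

namespace OutlierLDP

/-- A good rate function on `E`: it takes values in `[0, ∞]` (as a subset of the extended reals),
it is lower semicontinuous, and its sublevel sets at finite levels are compact. -/
structure IsGoodRateFunction {E : Type*} [TopologicalSpace E] (I : E → EReal) : Prop where
  nonneg : ∀ z, 0 ≤ I z
  lowerSemicontinuous : LowerSemicontinuous I
  isCompact_sublevel : ∀ a : ℝ, IsCompact {z | I z ≤ (a : EReal)}

/-- The large deviation principle with speed `n` and rate `I` for a sequence of Borel measures:
`limsup (1/n) log μ n F ≤ - inf_F I` for closed `F` and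
`- inf_G I ≤ liminf (1/n) log μ n G` for open `G` (with `log 0 = -∞`). -/
structure SatisfiesLDP {E : Type*} [TopologicalSpace E] [MeasurableSpace E]
    (μ : ℕ → Measure E) (I : E → EReal) : Prop where
  upper : ∀ F : Set E, IsClosed F →
    limsup (fun n : ℕ => ENNReal.log (μ n F) / (n : EReal)) atTop ≤ -(⨅ z ∈ F, I z)
  lower : ∀ G : Set E, IsOpen G →
    -(⨅ z ∈ G, I z) ≤ liminf (fun n : ℕ => ENNReal.log (μ n G) / (n : EReal)) atTop

/-- The support function `Δ*(y ∣ A) = sup {⟨y, θ⟩ : θ ∈ A}`, with values in the extended reals. -/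
def supportFun {k : ℕ} (A : Set (EuclideanSpace ℝ (Fin k))) (y : EuclideanSpace ℝ (Fin k)) :
    EReal :=
  ⨆ θ ∈ A, ((inner ℝ y θ : ℝ) : EReal)

/-- The product `a · z ∈ ℝᵐ` of an `m × d` matrix and a vector of `ℝᵈ`. -/
def matVec {m d : ℕ} (a : Matrix (Fin m) (Fin d) ℝ) (z : EuclideanSpace ℝ (Fin d)) :
    EuclideanSpace ℝ (Fin m) :=
  WithLp.toLp 2 (a.mulVec z.ofLp)

/-- The domain of the log-Laplace transform of a random vector `Y`:
`{θ : log 𝔼 exp ⟨θ, Y⟩ < ∞}`. -/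
def logLaplaceDomain {Ω : Type*} [MeasurableSpace Ω] (P : Measure Ω) {k : ℕ}
    (Y : Ω → EuclideanSpace ℝ (Fin k)) : Set (EuclideanSpace ℝ (Fin k)) :=
  {θ | ENNReal.log (∫⁻ ω, ENNReal.ofReal (Real.exp (inner ℝ θ (Y ω))) ∂P) < ⊤}

/-- The set `𝒟_y = {λ ∈ ℝᵐ : log 𝔼 exp ⟨λ, y · Z⟩ < ∞}` attached to an `m × d` matrix `y`. -/
def matDomain {Ω : Type*} [MeasurableSpace Ω] (P : Measure Ω) {m d : ℕ}
    (Z : Ω → EuclideanSpace ℝ (Fin d)) (y : Matrix (Fin m) (Fin d) ℝ) :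
    Set (EuclideanSpace ℝ (Fin m)) :=
  logLaplaceDomain P (fun ω => matVec y (Z ω))

/-- Painlevé–Kuratowski outer limit: limits of points chosen along a subsequence of the sets. -/
def outerLimit {M : Type*} [TopologicalSpace M] (D : ℕ → Set M) : Set M :=
  {x | ∃ φ : ℕ → ℕ, StrictMono φ ∧
    ∃ u : ℕ → M, (∀ n, u n ∈ D (φ n)) ∧ Tendsto u atTop (𝓝 x)}

/-- Painlevé–Kuratowski inner limit: limits of points chosen in all the sets from some rank on. -/
def innerLimit {M : Type*} [TopologicalSpace M] (D : ℕ → Set M) : Set M :=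
  {x | ∃ n₀ : ℕ, ∃ u : ℕ → M, (∀ n, n₀ ≤ n → u n ∈ D n) ∧ Tendsto u atTop (𝓝 x)}

/-- `Y` has some finite exponential moment, and `Y / n` satisfies the LDP with good rate
function `I`. -/
structure ParticleLDP {Ω : Type*} [MeasurableSpace Ω] (P : Measure Ω) {d : ℕ}
    (Y : Ω → EuclideanSpace ℝ (Fin d)) (I : EuclideanSpace ℝ (Fin d) → EReal) : Prop where
  expMoment : ∃ α : ℝ, 0 < α ∧ ∫⁻ ω, ENNReal.ofReal (Real.exp (α * ‖Y ω‖)) ∂P < ⊤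
  good : IsGoodRateFunction I
  ldp : SatisfiesLDP (fun n : ℕ => P.map (fun ω => (1 / (n : ℝ)) • Y ω)) I

/-- The sets `D n`, `n ≥ 1`, are non-empty and all contained in one compact set. -/
def CompactAssumption {M : Type*} [TopologicalSpace M] (D : ℕ → Set M) : Prop :=
  (∀ n, 1 ≤ n → (D n).Nonempty) ∧ ∃ K : Set M, IsCompact K ∧ ∀ n, 1 ≤ n → D n ⊆ K

/-- The inner and the outer limit of `D n` give the same intersection of the domains `𝒟_y`
(an intersection over the empty set is the whole space). -/
def LimitPointAssumption {Ω : Type*} [MeasurableSpace Ω] (P : Measure Ω) {m d : ℕ}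
    (Z : Ω → EuclideanSpace ℝ (Fin d)) (D : ℕ → Set (Matrix (Fin m) (Fin d) ℝ)) : Prop :=
  (⋂ y ∈ innerLimit D, matDomain P Z y) = (⋂ y ∈ outerLimit D, matDomain P Z y)

/-- The set `C_n^f = {f (x_i^n) : x_i^n ∈ C_n}`; here `C n` is the finite set of the indices `i`
of the points `x n i` that belong to the `n`-th (indexed) family of outliers. -/
def imageSet {X M : Type*} (x : ℕ → ℕ → X) (C : ℕ → Finset ℕ) (f : X → M) (n : ℕ) : Set M :=
  (fun i => f (x n i)) '' (C n : Set ℕ)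

/-- The partial sum `π_n = (1/n) ∑_{x_i^n ∈ C_n} f (x_i^n) · Z_i`. -/
def partialMean {X Ω : Type*} {m d : ℕ} (x : ℕ → ℕ → X) (C : ℕ → Finset ℕ)
    (f : X → Matrix (Fin m) (Fin d) ℝ) (Z : ℕ → Ω → EuclideanSpace ℝ (Fin d)) (n : ℕ) (ω : Ω) :
    EuclideanSpace ℝ (Fin m) :=
  (1 / (n : ℝ)) • ∑ i ∈ C n, matVec (f (x n i)) (Z i ω)

end OutlierLDP

end

namespace OutlierLDP

/-! ### Matrix-vector products -/

section MatVec

variable {m d : ℕ}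

/-! Since `card (C n) = o(n)`, bounded contributions disappear at speed `n`: only atypically large
values of single `Z i` move the mean. Both bounds reduce to one-particle estimates, and the convex
sets `matDomain` encode their costs.

Upper bound: for `l` in the intersection over the outer limit and `t < 1`, compactness bounds the
Laplace transforms of `f (x n i) · Z` at `t • l` by one constant `M` (`eventually_laplace_le`). By
independence the sum then has exponential moment at most `M ^ card (C n) = exp (o(n))`, so
Chernoff's bound on a half-space `{a < ⟨t • l, z⟩}` decays at rate `a`. Finitely many such
half-spaces cover a closed set on which the support function exceeds `a`. Compactness only gives
subsequential limits, hence the outer limit.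

Lower bound: by convex duality, the support function of an intersection of linear preimages is, up
to closure, the least total cost `∑ Δ*(w y)` over finite decompositions `z = ∑ y · w y`
(`mem_closure_decompositionCone`). Such a decomposition is realised by one particle per `y`, with
coefficient near `y` and value near `n • w y`, while all other particles stay bounded at total cost
`exp (-o(n))` (`le_liminf_of_decomposition`). A particle near `y` is needed for every large `n`,
hence the inner limit. Assumption (A-4) makes the two rates agree. -/

theorem matVec_add (y : Matrix (Fin m) (Fin d) ℝ) (z w : EuclideanSpace ℝ (Fin d)) :
    matVec y (z + w) = matVec y z + matVec y w := by
  ext i; simp [matVec, Matrix.mulVec_add]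

theorem matVec_smul (y : Matrix (Fin m) (Fin d) ℝ) (c : ℝ) (z : EuclideanSpace ℝ (Fin d)) :
    matVec y (c • z) = c • matVec y z := by
  ext i; simp [matVec, Matrix.mulVec_smul]

theorem inner_matVec (y : Matrix (Fin m) (Fin d) ℝ) (l : EuclideanSpace ℝ (Fin m))
    (z : EuclideanSpace ℝ (Fin d)) :
    (inner ℝ l (matVec y z) : ℝ) = inner ℝ (matVec y.transpose l) z := by
  simp only [matVec, EuclideanSpace.inner_eq_star_dotProduct, star_trivial]
  rw [dotProduct_comm, Matrix.dotProduct_mulVec, Matrix.mulVec_transpose, dotProduct_comm]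

theorem continuous_matVec :
    Continuous fun p : Matrix (Fin m) (Fin d) ℝ × EuclideanSpace ℝ (Fin d) =>
      matVec p.1 p.2 := by
  unfold matVec
  refine (PiLp.continuous_toLp 2 _).comp ?_
  exact continuous_fst.matrix_mulVec ((PiLp.continuous_ofLp 2 _).comp continuous_snd)

theorem measurable_matVec (y : Matrix (Fin m) (Fin d) ℝ) :
    Measurable (matVec y) :=
  (continuous_matVec.comp (Continuous.prodMk_right y)).measurable

/-- The map `z ↦ y · z` as a linear map. -/
noncomputable def matVecLin (y : Matrix (Fin m) (Fin d) ℝ) :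
    EuclideanSpace ℝ (Fin d) →ₗ[ℝ] EuclideanSpace ℝ (Fin m) where
  toFun := matVec y
  map_add' := matVec_add y
  map_smul' := matVec_smul y

/-- On a compact set of matrices, `z ↦ y · z` is bounded uniformly in `y`. -/
theorem exists_bound_matVec {K : Set (Matrix (Fin m) (Fin d) ℝ)} (hK : IsCompact K) :
    ∃ B : ℝ, 0 < B ∧ ∀ y ∈ K, ∀ z, ‖matVec y z‖ ≤ B * ‖z‖ := by
  obtain ⟨B, hB⟩ := (hK.prod (isCompact_closedBall (0 : EuclideanSpace ℝ (Fin d)) 1)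
    ).exists_bound_of_continuousOn (f := fun p => matVec p.1 p.2) continuous_matVec.continuousOn
  refine ⟨max B 1, by positivity, fun y hy z => ?_⟩
  rcases eq_or_ne z 0 with rfl | hz
  · simp [show matVec y 0 = 0 from map_zero (matVecLin y)]
  have hz' : 0 < ‖z‖ := norm_pos_iff.2 hz
  have h := hB (y, ‖z‖⁻¹ • z) ⟨hy, by simp [norm_smul, inv_mul_cancel₀ hz'.ne']⟩
  simp only [matVec_smul, norm_smul, norm_inv, norm_norm] at h
  rw [inv_mul_le_iff₀ hz'] at h
  nlinarith [le_max_left B 1]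

theorem isCompact_transpose {K : Set (Matrix (Fin m) (Fin d) ℝ)} (hK : IsCompact K) :
    IsCompact (Matrix.transpose '' K) :=
  hK.image continuous_id.matrix_transpose

/-- Allows convergent subsequences to be extracted from compact sets of matrices. -/
instance : FirstCountableTopology (Matrix (Fin m) (Fin d) ℝ) :=
  inferInstanceAs (FirstCountableTopology (Fin m → Fin d → ℝ))

end MatVec

/-! ### The Laplace transform and its domain -/

section Laplace

variable {Ω : Type*} [MeasurableSpace Ω] {P : Measure Ω} {k : ℕ}
  {Y : Ω → EuclideanSpace ℝ (Fin k)}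

/-- The Laplace transform `θ ↦ 𝔼 exp ⟨θ, Y⟩`. -/
noncomputable def laplace (P : Measure Ω) (Y : Ω → EuclideanSpace ℝ (Fin k)) (θ : EuclideanSpace ℝ (Fin k)) :
    ENNReal :=
  ∫⁻ ω, ENNReal.ofReal (Real.exp (inner ℝ θ (Y ω))) ∂P

theorem mem_logLaplaceDomain {θ : EuclideanSpace ℝ (Fin k)} :
    θ ∈ logLaplaceDomain P Y ↔ laplace P Y θ < ⊤ :=
  ENNReal.log_lt_top_iff

theorem measurable_exp_inner (hY : Measurable Y) (θ : EuclideanSpace ℝ (Fin k)) :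
    Measurable fun ω => ENNReal.ofReal (Real.exp (inner ℝ θ (Y ω))) :=
  (Real.measurable_exp.comp (measurable_const.inner hY)).ennreal_ofReal

theorem ofReal_exp_le_add_of_le_max {a b c : ℝ} (h : a ≤ max b c) :
    ENNReal.ofReal (Real.exp a) ≤ ENNReal.ofReal (Real.exp b) + ENNReal.ofReal (Real.exp c) := by
  rcases le_max_iff.1 h with h | h
  · exact (ENNReal.ofReal_le_ofReal (Real.exp_le_exp.2 h)).trans le_self_add
  · exact (ENNReal.ofReal_le_ofReal (Real.exp_le_exp.2 h)).trans le_add_self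

/-- Shrinking `θ` by `t` leaves room `1 - t`, which the exponential moment fills: the exponent is at
most a convex combination of `⟨θ, Y⟩` and `α * ‖Y‖`, hence at most their maximum. This replaces any
semicontinuity of the Laplace transform when matrices vary. -/
theorem laplace_smul_add_le (hY : Measurable Y) {α t : ℝ} (ht : 0 ≤ t) (ht1 : t ≤ 1)
    (θ e : EuclideanSpace ℝ (Fin k)) (he : ‖e‖ ≤ (1 - t) * α) :
    laplace P Y (t • θ + e) ≤
      laplace P Y θ + ∫⁻ ω, ENNReal.ofReal (Real.exp (α * ‖Y ω‖)) ∂P := by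
  unfold laplace
  rw [← lintegral_add_left (measurable_exp_inner hY θ)]
  refine lintegral_mono fun ω => ofReal_exp_le_add_of_le_max ?_
  rw [inner_add_left, real_inner_smul_left]
  have h1 : (inner ℝ e (Y ω) : ℝ) ≤ (1 - t) * (α * ‖Y ω‖) := by
    refine (real_inner_le_norm _ _).trans ?_
    rw [← mul_assoc]
    exact mul_le_mul_of_nonneg_right he (norm_nonneg _)
  have h2 := mul_le_mul_of_nonneg_left (le_max_left (inner ℝ θ (Y ω)) (α * ‖Y ω‖)) ht
  have h3 := mul_le_mul_of_nonneg_left (le_max_right (inner ℝ θ (Y ω)) (α * ‖Y ω‖))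
    (sub_nonneg.2 ht1)
  linarith

theorem convex_logLaplaceDomain (hY : Measurable Y) : Convex ℝ (logLaplaceDomain P Y) := by
  intro θ hθ θ' hθ' a b ha hb hab
  rw [mem_logLaplaceDomain] at *
  refine lt_of_le_of_lt ?_ (ENNReal.add_lt_top.2 ⟨hθ, hθ'⟩)
  unfold laplace
  rw [← lintegral_add_left (measurable_exp_inner hY θ)]
  refine lintegral_mono fun ω => ofReal_exp_le_add_of_le_max ?_
  rw [inner_add_left, real_inner_smul_left, real_inner_smul_left]
  have h2 := mul_le_mul_of_nonneg_left (le_max_left (inner ℝ θ (Y ω)) (inner ℝ θ' (Y ω))) ha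
  have h3 := mul_le_mul_of_nonneg_left (le_max_right (inner ℝ θ (Y ω)) (inner ℝ θ' (Y ω))) hb
  have h4 : a * max (inner ℝ θ (Y ω)) (inner ℝ θ' (Y ω)) +
    b * max (inner ℝ θ (Y ω)) (inner ℝ θ' (Y ω)) =
    max (inner ℝ θ (Y ω)) (inner ℝ θ' (Y ω)) := by rw [← add_mul, hab, one_mul]
  linarith

theorem zero_mem_logLaplaceDomain [IsFiniteMeasure P] : 0 ∈ logLaplaceDomain P Y := by
  simp [mem_logLaplaceDomain, laplace, measure_lt_top]

theorem mem_logLaplaceDomain_of_norm_le {α : ℝ}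
    (hα : ∫⁻ ω, ENNReal.ofReal (Real.exp (α * ‖Y ω‖)) ∂P < ⊤) {θ : EuclideanSpace ℝ (Fin k)}
    (hθ : ‖θ‖ ≤ α) : θ ∈ logLaplaceDomain P Y := by
  rw [mem_logLaplaceDomain]
  refine lt_of_le_of_lt (lintegral_mono fun ω => ENNReal.ofReal_le_ofReal
    (Real.exp_le_exp.2 ?_)) hα
  exact (real_inner_le_norm _ _).trans (mul_le_mul_of_nonneg_right hθ (norm_nonneg _))

/-- A point dominated by the support function of the domain is, after shrinking by a factor
smaller than one, in the domain. -/
theorem smul_mem_logLaplaceDomain_of_le_support (hY : Measurable Y) {α : ℝ} (hα0 : 0 < α)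
    (hα : ∫⁻ ω, ENNReal.ofReal (Real.exp (α * ‖Y ω‖)) ∂P < ⊤) {θ : EuclideanSpace ℝ (Fin k)}
    (hθ : ∀ (w : EuclideanSpace ℝ (Fin k)) (s : ℝ),
      (∀ θ' ∈ logLaplaceDomain P Y, (inner ℝ w θ' : ℝ) ≤ s) → (inner ℝ w θ : ℝ) ≤ s)
    {t : ℝ} (ht : 0 ≤ t) (ht1 : t < 1) : t • θ ∈ logLaplaceDomain P Y := by
  -- A point outside the closed convex hull would be strictly separated, contradicting domination by
  -- the support function.
  have hcl : θ ∈ closure (logLaplaceDomain P Y) := by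
    by_contra hn
    obtain ⟨l, u, h1, h2⟩ := geometric_hahn_banach_closed_point
      (convex_logLaplaceDomain (P := P) hY).closure isClosed_closure hn
    have hl : ∀ v, (inner ℝ ((InnerProductSpace.toDual ℝ _).symm l) v : ℝ) = l v := fun v => by
      simp
    have := hθ ((InnerProductSpace.toDual ℝ _).symm l) u fun θ' h' => by
      rw [hl]; exact (h1 θ' (subset_closure h')).le
    rw [hl] at this
    linarith
  obtain ⟨θ', hθ', hd⟩ := Metric.mem_closure_iff.1 hcl ((1 - t) * α)
    (mul_pos (sub_pos.2 ht1) hα0)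
  have h := laplace_smul_add_le (P := P) hY ht ht1.le θ' (t • (θ - θ')) (α := α) (by
    rw [norm_smul, Real.norm_of_nonneg ht, ← dist_eq_norm]
    exact (mul_le_of_le_one_left dist_nonneg ht1.le).trans hd.le)
  rw [← smul_add, add_sub_cancel] at h
  exact mem_logLaplaceDomain.2 (h.trans_lt (ENNReal.add_lt_top.2
    ⟨mem_logLaplaceDomain.1 hθ', hα⟩))

theorem mem_matDomain {m d : ℕ} {Z : Ω → EuclideanSpace ℝ (Fin d)}
    {y : Matrix (Fin m) (Fin d) ℝ} {l : EuclideanSpace ℝ (Fin m)} :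
    l ∈ matDomain P Z y ↔ matVec y.transpose l ∈ logLaplaceDomain P Z := by
  simp only [matDomain, logLaplaceDomain, inner_matVec, Set.mem_ofPred_eq]

end Laplace

/-! ### Support functions -/

section Support

variable {k : ℕ} {A : Set (EuclideanSpace ℝ (Fin k))}

theorem supportFun_le_coe {y : EuclideanSpace ℝ (Fin k)} {s : ℝ} :
    supportFun A y ≤ (s : EReal) ↔ ∀ θ ∈ A, (inner ℝ y θ : ℝ) ≤ s := by
  simp [supportFun, iSup_le_iff]

theorem coe_inner_le_supportFun {y θ : EuclideanSpace ℝ (Fin k)} (h : θ ∈ A) :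
    ((inner ℝ y θ : ℝ) : EReal) ≤ supportFun A y :=
  le_iSup₂ (f := fun θ (_ : θ ∈ A) => ((inner ℝ y θ : ℝ) : EReal)) θ h

/-- Testing against the point of norm `r` in the direction of `z` gives `r * ‖z‖ ≤ supportFun A z`,
so sublevel sets are bounded. -/
theorem isGoodRateFunction_supportFun {r : ℝ} (hr : 0 < r) (hA : Metric.closedBall 0 r ⊆ A) :
    IsGoodRateFunction (supportFun A) where
  nonneg z := by
    have := coe_inner_le_supportFun (y := z) (hA (Metric.mem_closedBall_self hr.le))
    simpa using this
  lowerSemicontinuous := by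
    refine lowerSemicontinuous_iSup fun θ => lowerSemicontinuous_iSup fun _ => ?_
    exact (continuous_coe_real_ereal.comp (continuous_id.inner continuous_const)).lowerSemicontinuous
  isCompact_sublevel a := by
    refine Metric.isCompact_of_isClosed_isBounded ?_ ?_
    · have : {z | supportFun A z ≤ (a : EReal)} = ⋂ θ ∈ A, {z | (inner ℝ z θ : ℝ) ≤ a} := by
        ext z; simp [supportFun_le_coe]
      rw [this]
      exact isClosed_biInter fun θ _ =>
        isClosed_le (continuous_id.inner continuous_const) continuous_const
    · refine (Metric.isBounded_closedBall (x := (0 : EuclideanSpace ℝ (Fin k)))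
        (r := a / r)).subset fun z hz => ?_
      rw [mem_closedBall_zero_iff, le_div_iff₀ hr]
      rcases eq_or_ne z 0 with rfl | hz0
      · simpa using supportFun_le_coe.1 hz _ (hA (Metric.mem_closedBall_self hr.le))
      have hz' : 0 < ‖z‖ := norm_pos_iff.2 hz0
      have := supportFun_le_coe.1 hz ((r * ‖z‖⁻¹) • z) (hA (by
        rw [mem_closedBall_zero_iff, norm_smul, Real.norm_of_nonneg (by positivity)]
        field_simp; rfl))
      rw [real_inner_smul_right, real_inner_self_eq_norm_sq] at this
      field_simp at this
      linarith

end Support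

end OutlierLDP
namespace OutlierLDP

/-! ### Support functions of intersections of linear preimages -/

section Decomposition

variable {m d : ℕ}

/-- The linear map sending a finitely supported family `y ↦ (w y, s y)` to
`(∑ y · w y, ∑ s y)`. -/
noncomputable def decompositionMap (m d : ℕ) :
    (Matrix (Fin m) (Fin d) ℝ →₀ EuclideanSpace ℝ (Fin d) × ℝ) →ₗ[ℝ]
      EuclideanSpace ℝ (Fin m) × ℝ :=
  Finsupp.lsum ℝ fun y => LinearMap.prodMap (matVecLin y) LinearMap.id

/-- The convex cone of all `(∑ y · w y, s)`, where `y` ranges over finitely many elements of `T`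
and `s` is at least the sum of the values at `w y` of the support function of `A`. -/
def decompositionCone (T : Set (Matrix (Fin m) (Fin d) ℝ)) (A : Set (EuclideanSpace ℝ (Fin d))) :
    Set (EuclideanSpace ℝ (Fin m) × ℝ) :=
  {p | ∃ g : Matrix (Fin m) (Fin d) ℝ →₀ EuclideanSpace ℝ (Fin d) × ℝ,
    (g.support : Set _) ⊆ T ∧ (∀ y, ∀ θ ∈ A, (inner ℝ (g y).1 θ : ℝ) ≤ (g y).2) ∧
    (decompositionMap m d g).1 = p.1 ∧ (decompositionMap m d g).2 ≤ p.2}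

variable {T : Set (Matrix (Fin m) (Fin d) ℝ)} {A : Set (EuclideanSpace ℝ (Fin d))}

theorem add_mem_decompositionCone {p q : EuclideanSpace ℝ (Fin m) × ℝ}
    (hp : p ∈ decompositionCone T A) (hq : q ∈ decompositionCone T A) :
    p + q ∈ decompositionCone T A := by
  obtain ⟨g, hg, hgA, hg1, hg2⟩ := hp
  obtain ⟨h, hh, hhA, hh1, hh2⟩ := hq
  classical
  refine ⟨g + h, ?_, fun y θ hθ => ?_, ?_, ?_⟩
  · refine (Finset.coe_subset.2 Finsupp.support_add).trans ?_
    rw [Finset.coe_union]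
    exact Set.union_subset hg hh
  · simpa [inner_add_left] using add_le_add (hgA y θ hθ) (hhA y θ hθ)
  · simp [hg1, hh1]
  · simpa using add_le_add hg2 hh2

theorem smul_mem_decompositionCone {p : EuclideanSpace ℝ (Fin m) × ℝ} {c : ℝ} (hc : 0 ≤ c)
    (hp : p ∈ decompositionCone T A) : c • p ∈ decompositionCone T A := by
  obtain ⟨g, hg, hgA, hg1, hg2⟩ := hp
  refine ⟨c • g, (Finset.coe_subset.2 Finsupp.support_smul).trans hg, fun y θ hθ => ?_, ?_, ?_⟩
  · simpa [inner_smul_left] using mul_le_mul_of_nonneg_left (hgA y θ hθ) hc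
  · simp [hg1]
  · simpa using mul_le_mul_of_nonneg_left hg2 hc

theorem convex_decompositionCone : Convex ℝ (decompositionCone T A) :=
  fun _ hp _ hq _ _ ha hb _ => add_mem_decompositionCone (smul_mem_decompositionCone ha hp)
    (smul_mem_decompositionCone hb hq)

theorem zero_prod_mem_decompositionCone {s : ℝ} (hs : 0 ≤ s) :
    ((0, s) : EuclideanSpace ℝ (Fin m) × ℝ) ∈ decompositionCone T A :=
  ⟨0, by simp, by simp, by simp, by simpa⟩

theorem matVec_mem_decompositionCone {y : Matrix (Fin m) (Fin d) ℝ} (hy : y ∈ T)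
    {w : EuclideanSpace ℝ (Fin d)} {s : ℝ} (hw : ∀ θ ∈ A, (inner ℝ w θ : ℝ) ≤ s) :
    (matVec y w, s) ∈ decompositionCone T A := by
  classical
  refine ⟨Finsupp.single y (w, s), ?_, fun y' θ hθ => ?_, ?_, ?_⟩
  · refine (Finset.coe_subset.2 Finsupp.support_single_subset).trans ?_
    simpa
  · rcases eq_or_ne y' y with rfl | h
    · simpa using hw θ hθ
    · simp [Finsupp.single_eq_of_ne h]
  · rw [decompositionMap, Finsupp.lsum_single]; rfl
  · rw [decompositionMap, Finsupp.lsum_single]; rfl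

variable {Ω : Type*} [MeasurableSpace Ω] {P : Measure Ω} [IsFiniteMeasure P]
  {Y : Ω → EuclideanSpace ℝ (Fin d)}

/-- Bipolar argument in `ℝᵐ × ℝ`: a hyperplane separating `(z, j)` from the cone would yield
multiples of its normal `l` that lie in the intersection of the domains and on which `z` exceeds
`j`. -/
theorem mem_closure_decompositionCone (hY : Measurable Y) {α : ℝ} (hα0 : 0 < α)
    (hα : ∫⁻ ω, ENNReal.ofReal (Real.exp (α * ‖Y ω‖)) ∂P < ⊤)
    {z : EuclideanSpace ℝ (Fin m)} {j : ℝ}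
    (hz : supportFun (⋂ y ∈ T, matDomain P Y y) z ≤ (j : EReal)) :
    (z, j) ∈ closure (decompositionCone T (logLaplaceDomain P Y)) := by
  by_contra hn
  obtain ⟨f, u, h1, h2⟩ := geometric_hahn_banach_closed_point
    convex_decompositionCone.closure isClosed_closure hn
  have hu : 0 < u := by
    have := h1 (0, 0) (subset_closure (zero_prod_mem_decompositionCone le_rfl))
    rw [show ((0, 0) : EuclideanSpace ℝ (Fin m) × ℝ) = 0 from rfl, map_zero] at this
    exact this
  -- On a cone, a functional bounded above is nonpositive: otherwise scale `p` until the value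
  -- reaches `u`.
  have hle : ∀ p ∈ decompositionCone T (logLaplaceDomain P Y), f p ≤ 0 := by
    intro p hp
    by_contra! h
    have := h1 _ (subset_closure (smul_mem_decompositionCone (div_pos hu h).le hp))
    rw [map_smul, smul_eq_mul, div_mul_cancel₀ _ h.ne'] at this
    exact lt_irrefl _ this
  set l : EuclideanSpace ℝ (Fin m) := (InnerProductSpace.toDual ℝ _).symm
    (f.comp (ContinuousLinearMap.inl ℝ _ _)) with hl
  set β : ℝ := -f (0, 1) with hβ
  have hf : ∀ v s, f (v, s) = inner ℝ l v - β * s := by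
    intro v s
    have e : ((v, s) : EuclideanSpace ℝ (Fin m) × ℝ) = (v, 0) + s • ((0, 1) : _ × ℝ) := by
      simp
    rw [e, map_add, map_smul, hl, hβ, InnerProductSpace.toDual_symm_apply, smul_eq_mul]
    simp only [ContinuousLinearMap.comp_apply, ContinuousLinearMap.inl_apply]
    ring
  have hβ0 : 0 ≤ β := by
    have := hle (0, 1) (zero_prod_mem_decompositionCone zero_le_one)
    rw [hβ]; linarith
  have hpos : 0 < inner ℝ l z - β * j := by rw [← hf]; exact hu.trans h2
  -- The slope `β` may vanish (vertical hyperplane), so one cannot divide by it; all `c` with `c * β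
  -- < 1` are used instead.
  have key : ∀ c : ℝ, 0 < c → c * β < 1 → c * inner ℝ l z ≤ j := by
    intro c hc hcβ
    -- The midpoint satisfies `c * β ≤ t < 1`: the first inequality makes `(c / t) • yᵀ l` dominated
    -- by the support function, the second returns its `t`-multiple to the domain, which need not be
    -- closed.
    set t : ℝ := (1 + c * β) / 2 with ht
    have hcβ0 : 0 ≤ c * β := mul_nonneg hc.le hβ0
    have ht0 : 0 < t := by rw [ht]; positivity
    have hD : c • l ∈ ⋂ y ∈ T, matDomain P Y y := by
      refine Set.mem_iInter₂.2 fun y hy => mem_matDomain.2 ?_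
      have := smul_mem_logLaplaceDomain_of_le_support (P := P) hY hα0 hα
        (θ := (c / t) • matVec y.transpose l) (fun w s hw => ?_) ht0.le (by rw [ht]; linarith)
      · rwa [smul_smul, mul_div_cancel₀ _ ht0.ne', ← matVec_smul] at this
      · have hs : 0 ≤ s := by simpa using hw 0 zero_mem_logLaplaceDomain
        have h3 := hle _ (matVec_mem_decompositionCone hy hw)
        rw [hf, inner_matVec] at h3
        rw [real_inner_smul_right, real_inner_comm, div_mul_eq_mul_div, div_le_iff₀ ht0]
        have h4 : c * inner ℝ (matVec y.transpose l) w ≤ c * (β * s) :=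
          mul_le_mul_of_nonneg_left (by linarith) hc.le
        have h5 : (c * β) * s ≤ t * s :=
          mul_le_mul_of_nonneg_right (by rw [ht]; linarith) hs
        linarith
    have := supportFun_le_coe.1 hz _ hD
    rwa [real_inner_smul_right, real_inner_comm] at this
  have hj : 0 ≤ j := by
    have := supportFun_le_coe.1 hz 0 (Set.mem_iInter₂.2 fun y _ => mem_matDomain.2 (by
      rw [show matVec y.transpose 0 = 0 from map_zero (matVecLin _)]
      exact zero_mem_logLaplaceDomain))
    simpa using this
  have hlz : inner ℝ l z ≤ β * j := by
    refine le_of_forall_pos_le_add fun δ hδ => ?_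
    -- Here `c` is the inverse of a number slightly above `β`; dividing by `j + 1` keeps the error
    -- below `δ` and allows `j = 0`.
    have hb : 0 < β + δ / (j + 1) := by positivity
    have := key (β + δ / (j + 1))⁻¹ (inv_pos.2 hb) (by
      rw [inv_mul_lt_iff₀ hb]; linarith [show 0 < δ / (j + 1) by positivity])
    rw [inv_mul_le_iff₀ hb] at this
    have h6 : δ / (j + 1) * j ≤ δ := by
      rw [div_mul_eq_mul_div, div_le_iff₀ (by positivity)]; nlinarith
    linarith
  linarith

/-- Every point where the support function of the intersection of the domains is at most `j` is
approximated by sums `∑ y · w y` over finitely many `y ∈ T`, with total cost close to `j`. -/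
theorem exists_approx_decomposition (hY : Measurable Y) {α : ℝ} (hα0 : 0 < α)
    (hα : ∫⁻ ω, ENNReal.ofReal (Real.exp (α * ‖Y ω‖)) ∂P < ⊤)
    {z : EuclideanSpace ℝ (Fin m)} {j : ℝ}
    (hz : supportFun (⋂ y ∈ T, matDomain P Y y) z ≤ (j : EReal)) {ε : ℝ} (hε : 0 < ε) :
    ∃ (S : Finset (Matrix (Fin m) (Fin d) ℝ))
      (w : Matrix (Fin m) (Fin d) ℝ → EuclideanSpace ℝ (Fin d))
      (s : Matrix (Fin m) (Fin d) ℝ → ℝ),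
      (S : Set _) ⊆ T ∧ (∀ y, ∀ θ ∈ logLaplaceDomain P Y, (inner ℝ (w y) θ : ℝ) ≤ s y) ∧
      ‖∑ y ∈ S, matVec y (w y) - z‖ < ε ∧ ∑ y ∈ S, s y < j + ε := by
  obtain ⟨p, ⟨g, hgT, hgA, hg1, hg2⟩, hp⟩ :=
    Metric.mem_closure_iff.1 (mem_closure_decompositionCone hY hα0 hα hz) ε hε
  rw [Prod.dist_eq, max_lt_iff] at hp
  have e : decompositionMap m d g =
      (∑ y ∈ g.support, matVec y (g y).1, ∑ y ∈ g.support, (g y).2) := by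
    simp [decompositionMap, Finsupp.sum, Prod.ext_iff, Prod.fst_sum, Prod.snd_sum, matVecLin]
  rw [e] at hg1 hg2
  refine ⟨g.support, fun y => (g y).1, fun y => (g y).2, hgT, hgA, ?_, ?_⟩
  · simp only at hg1
    rw [hg1, ← dist_eq_norm, dist_comm]
    exact hp.1
  · have := hp.2
    rw [Real.dist_eq, abs_lt] at this
    simp only at hg2 this
    linarith

end Decomposition

end OutlierLDP
namespace OutlierLDP

/-! ### Logarithmic asymptotics -/

section LogAsymptotics

theorem log_ofReal_exp_div (r : ℝ) (n : ℕ) :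
    ENNReal.log (ENNReal.ofReal (Real.exp r)) / (n : EReal) = ((r / n : ℝ) : EReal) := by
  rw [ENNReal.log_ofReal_of_pos (Real.exp_pos _), Real.log_exp, EReal.coe_div,
    EReal.coe_natCast]

theorem limsup_log_div_le {u : ℕ → ENNReal} {r : ℕ → ℝ} {b : ℝ}
    (hu : ∀ᶠ n in atTop, u n ≤ ENNReal.ofReal (Real.exp (r n)))
    (hr : Tendsto (fun n : ℕ => r n / n) atTop (𝓝 b)) :
    limsup (fun n : ℕ => ENNReal.log (u n) / (n : EReal)) atTop ≤ (b : EReal) := by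
  rw [← ((continuous_coe_real_ereal.tendsto b).comp hr).limsup_eq]
  refine limsup_le_limsup ?_
  filter_upwards [hu] with n hn
  rw [Function.comp_apply, ← log_ofReal_exp_div]
  exact EReal.div_le_div_right_of_nonneg (by positivity) (ENNReal.log_le_log hn)

theorem le_liminf_log_div {u : ℕ → ENNReal} {r : ℕ → ℝ} {b : ℝ}
    (hu : ∀ᶠ n in atTop, ENNReal.ofReal (Real.exp (r n)) ≤ u n)
    (hr : Tendsto (fun n : ℕ => r n / n) atTop (𝓝 b)) :
    (b : EReal) ≤ liminf (fun n : ℕ => ENNReal.log (u n) / (n : EReal)) atTop := by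
  rw [← ((continuous_coe_real_ereal.tendsto b).comp hr).liminf_eq]
  refine liminf_le_liminf ?_
  filter_upwards [hu] with n hn
  rw [Function.comp_apply, ← log_ofReal_exp_div]
  exact EReal.div_le_div_right_of_nonneg (by positivity) (ENNReal.log_le_log hn)

theorem eventually_exp_le_of_lt_liminf {u : ℕ → ENNReal} {b : ℝ}
    (h : (b : EReal) < liminf (fun n : ℕ => ENNReal.log (u n) / (n : EReal)) atTop) :
    ∀ᶠ n : ℕ in atTop, ENNReal.ofReal (Real.exp (n * b)) ≤ u n := by
  filter_upwards [eventually_lt_of_lt_liminf h, eventually_gt_atTop 0] with n hn hn0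
  have hn0' : (n : ℝ) ≠ 0 := by positivity
  rw [← ENNReal.log_le_log_iff]
  have h1 := log_ofReal_exp_div (n * b) n
  rw [mul_div_cancel_left₀ _ hn0'] at h1
  rw [← h1] at hn
  by_contra! hlt
  exact absurd (EReal.div_le_div_right_of_nonneg (c := (n : EReal)) (by positivity) hlt.le)
    (not_le.2 hn)

end LogAsymptotics

/-! ### Upper bound -/

section Upper

variable {Ω : Type*} [MeasurableSpace Ω] {P : Measure Ω} {m d : ℕ}

/-- If no bound held, matrices with transforms tending to infinity would accumulate at some `y₀` in
the outer limit. There `y₀ᵀ l` has a finite transform, and the slack `1 - t` absorbs the distance to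
nearby matrices. -/
theorem eventually_laplace_le {Y : Ω → EuclideanSpace ℝ (Fin d)} (hY : Measurable Y) {α : ℝ}
    (hα0 : 0 < α) (hα : ∫⁻ ω, ENNReal.ofReal (Real.exp (α * ‖Y ω‖)) ∂P < ⊤)
    {D : ℕ → Set (Matrix (Fin m) (Fin d) ℝ)} (hD : CompactAssumption D)
    {l : EuclideanSpace ℝ (Fin m)} (hl : l ∈ ⋂ y ∈ outerLimit D, matDomain P Y y)
    {t : ℝ} (ht : 0 ≤ t) (ht1 : t < 1) :
    ∃ M : ℝ, 1 ≤ M ∧ ∀ᶠ n in atTop, ∀ y ∈ D n,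
      laplace P Y (matVec y.transpose (t • l)) ≤ ENNReal.ofReal M := by
  by_contra! hcon
  have hfreq : ∀ k : ℕ, ∃ᶠ n in atTop, 1 ≤ n ∧ ∃ y ∈ D n,
      ENNReal.ofReal ((k : ℝ) + 1) < laplace P Y (matVec y.transpose (t • l)) := by
    intro k
    refine ((eventually_ge_atTop 1).and_frequently ((hcon (k + 1) (by simp)).mono ?_))
    exact fun n h => h
  obtain ⟨φ, hφ, hφ'⟩ := extraction_forall_of_frequently hfreq
  choose h1 y hy hlt using hφ'
  obtain ⟨K, hK, hDK⟩ := hD.2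
  obtain ⟨y₀, -, ψ, hψ, hlim⟩ := hK.tendsto_subseq fun n => hDK _ (h1 n) (hy n)
  have hy₀ : y₀ ∈ outerLimit D := ⟨φ ∘ ψ, hφ.comp hψ, y ∘ ψ, fun n => hy (ψ n), hlim⟩
  have hmem := mem_logLaplaceDomain.1 (mem_matDomain.1 (Set.mem_iInter₂.1 hl y₀ hy₀))
  set θ := matVec y₀.transpose l with hθ
  have hcont : Tendsto (fun n => matVec (y (ψ n)).transpose (t • l)) atTop
      (𝓝 (matVec y₀.transpose (t • l))) := by
    have hc : Continuous fun y : Matrix (Fin m) (Fin d) ℝ => matVec y.transpose (t • l) :=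
      continuous_matVec.comp (continuous_id.matrix_transpose.prodMk continuous_const)
    exact (hc.tendsto y₀).comp hlim
  have hsmall := (tendsto_iff_norm_sub_tendsto_zero.1 hcont).eventually
    (ge_mem_nhds (mul_pos (sub_pos.2 ht1) hα0))
  have htop := ENNReal.add_lt_top.2 ⟨hmem, hα⟩
  set N := laplace P Y θ + ∫⁻ ω, ENNReal.ofReal (Real.exp (α * ‖Y ω‖)) ∂P with hN
  obtain ⟨n, hn, hn'⟩ := (hsmall.and (eventually_ge_atTop ⌈N.toReal⌉₊)).exists
  have h := laplace_smul_add_le (P := P) hY ht ht1.le θ _ hn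
  rw [matVec_smul, matVec_smul, ← hθ, add_sub_cancel, ← matVec_smul] at h
  refine absurd ((hlt (ψ n)).trans_le h) (not_lt.2 ?_)
  rw [← hN, ← ENNReal.ofReal_toReal htop.ne]
  refine ENNReal.ofReal_le_ofReal ((Nat.le_ceil _).trans ?_)
  have : (⌈N.toReal⌉₊ : ℝ) ≤ ψ n := by exact_mod_cast hn'.trans (hψ.id_le n)
  linarith

variable {Z : ℕ → Ω → EuclideanSpace ℝ (Fin d)}

theorem lintegral_exp_inner_sum (hZ_meas : ∀ i, Measurable (Z i)) (hZ_indep : iIndepFun Z P)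
    (hZ_ident : ∀ i, IdentDistrib (Z i) (Z 1) P P) (s : Finset ℕ)
    (y : ℕ → Matrix (Fin m) (Fin d) ℝ) (l : EuclideanSpace ℝ (Fin m)) :
    ∫⁻ ω, ENNReal.ofReal (Real.exp (inner ℝ l (∑ i ∈ s, matVec (y i) (Z i ω)))) ∂P =
      ∏ i ∈ s, laplace P (Z 1) (matVec (y i).transpose l) := by
  have hg : ∀ i, Measurable fun z : EuclideanSpace ℝ (Fin d) =>
      ENNReal.ofReal (Real.exp (inner ℝ (matVec (y i).transpose l) z)) :=
    fun i => measurable_exp_inner measurable_id _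
  have h := lintegral_prod_eq_prod_lintegral_of_indepFun s _ (hZ_indep.comp _ hg)
    fun i => (hg i).comp (hZ_meas i)
  simp only [Function.comp_apply] at h
  have h2 : ∀ i, ∫⁻ ω, ENNReal.ofReal (Real.exp (inner ℝ (matVec (y i).transpose l) (Z i ω))) ∂P
      = laplace P (Z 1) (matVec (y i).transpose l) :=
    fun i => ((hZ_ident i).comp (hg i)).lintegral_eq
  simp only [h2] at h
  rw [← h]
  refine lintegral_congr fun ω => ?_
  rw [← ENNReal.ofReal_prod_of_nonneg fun i _ => (Real.exp_pos _).le, ← Real.exp_sum, inner_sum]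
  simp only [inner_matVec]

variable {X : Type*} {f : X → Matrix (Fin m) (Fin d) ℝ} {x : ℕ → ℕ → X} {C : ℕ → Finset ℕ}

theorem measurable_partialMean (hZ_meas : ∀ i, Measurable (Z i)) (n : ℕ) :
    Measurable (partialMean x C f Z n) := by
  unfold partialMean
  exact (Finset.measurable_sum _ fun i _ =>
    (measurable_matVec _).comp (hZ_meas i)).const_smul (1 / (n : ℝ))

theorem isOpen_halfSpace {k : ℕ} (l : EuclideanSpace ℝ (Fin k)) (a : ℝ) :
    IsOpen {z | a < (inner ℝ l z : ℝ)} :=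
  isOpen_lt continuous_const (continuous_const.inner continuous_id)

/-- Exponential Markov inequality, with the moment factorised by independence. -/
theorem map_partialMean_halfSpace_le (hZ_meas : ∀ i, Measurable (Z i)) (hZ_indep : iIndepFun Z P)
    (hZ_ident : ∀ i, IdentDistrib (Z i) (Z 1) P P) {n : ℕ} (hn : n ≠ 0)
    (l : EuclideanSpace ℝ (Fin m)) (a : ℝ) :
    P.map (partialMean x C f Z n) {z | a < inner ℝ l z} ≤ ENNReal.ofReal (Real.exp (-(n * a))) *
      ∏ i ∈ C n, laplace P (Z 1) (matVec (f (x n i)).transpose l) := by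
  have hn' : (0 : ℝ) < n := by positivity
  rw [Measure.map_apply (measurable_partialMean hZ_meas n)
    (isOpen_halfSpace l a).measurableSet]
  rw [← lintegral_exp_inner_sum hZ_meas hZ_indep hZ_ident,
    ← lintegral_const_mul' _ _ ENNReal.ofReal_ne_top,
    ← one_mul (P _), ← setLIntegral_const]
  refine (setLIntegral_mono' ?_ fun ω hω => ?_).trans (setLIntegral_le_lintegral _ _)
  · exact measurable_partialMean hZ_meas n
      (isOpen_halfSpace l a).measurableSet
  · rw [← ENNReal.ofReal_mul (Real.exp_pos _).le, ← Real.exp_add, ENNReal.one_le_ofReal,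
      Real.one_le_exp_iff]
    have h : a < inner ℝ l (partialMean x C f Z n ω) := hω
    rw [partialMean, real_inner_smul_right, one_div, lt_inv_mul_iff₀ hn'] at h
    linarith

theorem eventually_map_halfSpace_le (hZ_meas : ∀ i, Measurable (Z i)) (hZ_indep : iIndepFun Z P)
    (hZ_ident : ∀ i, IdentDistrib (Z i) (Z 1) P P) {l : EuclideanSpace ℝ (Fin m)} {a M : ℝ}
    (hM : 1 ≤ M) (h : ∀ᶠ n in atTop, ∀ y ∈ imageSet x C f n,
      laplace P (Z 1) (matVec y.transpose l) ≤ ENNReal.ofReal M) :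
    ∀ᶠ n in atTop, P.map (partialMean x C f Z n) {z | a < inner ℝ l z} ≤
      ENNReal.ofReal (Real.exp ((C n).card * Real.log M - n * a)) := by
  filter_upwards [h, eventually_ne_atTop 0] with n hn hn0
  refine (map_partialMean_halfSpace_le hZ_meas hZ_indep hZ_ident hn0 l a).trans ?_
  have : ∏ i ∈ C n, laplace P (Z 1) (matVec (f (x n i)).transpose l) ≤
      ENNReal.ofReal (Real.exp ((C n).card * Real.log M)) := by
    refine (Finset.prod_le_pow_card _ _ _ fun i hi => hn _ ⟨i, hi, rfl⟩).trans ?_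
    rw [mul_comm, Real.exp_mul, Real.exp_log (by positivity), Real.rpow_natCast,
      ENNReal.ofReal_pow (by positivity)]
  refine (mul_le_mul_right this _).trans ?_
  rw [← ENNReal.ofReal_mul (Real.exp_pos _).le, ← Real.exp_add]
  exact ENNReal.ofReal_le_ofReal (Real.exp_le_exp.2 (by linarith))

/-- If a set is covered by finitely many half spaces `{z | a < ⟨l, z⟩}` with controlled Laplace
transforms, then `-a` bounds its exponential decay rate. -/
theorem limsup_le_of_subset_halfSpaces (hZ_meas : ∀ i, Measurable (Z i))
    (hZ_indep : iIndepFun Z P) (hZ_ident : ∀ i, IdentDistrib (Z i) (Z 1) P P)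
    (hC_card : Tendsto (fun n : ℕ => ((C n).card : ℝ) / (n : ℝ)) atTop (𝓝 0))
    {L : Finset (EuclideanSpace ℝ (Fin m))} {a : ℝ} {F : Set (EuclideanSpace ℝ (Fin m))}
    (hL : ∀ l ∈ L, ∃ M : ℝ, 1 ≤ M ∧ ∀ᶠ n in atTop, ∀ y ∈ imageSet x C f n,
      laplace P (Z 1) (matVec y.transpose l) ≤ ENNReal.ofReal M)
    (hF : F ⊆ ⋃ l ∈ L, {z | a < inner ℝ l z}) :
    limsup (fun n : ℕ => ENNReal.log (P.map (partialMean x C f Z n) F) / (n : EReal)) atTop ≤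
      ((-a : ℝ) : EReal) := by
  choose! M hM1 hM using hL
  -- As each `M l ≥ 1`, the sum of the logarithms dominates each of them.
  set R : ℝ := ∑ l ∈ L, Real.log (M l) with hR
  have hMR : ∀ l ∈ L, Real.log (M l) ≤ R := fun l hl =>
    Finset.single_le_sum (f := fun l => Real.log (M l))
      (fun i hi => Real.log_nonneg (hM1 i hi)) hl
  have hev : ∀ᶠ n in atTop, ∀ l ∈ L, P.map (partialMean x C f Z n) {z | a < inner ℝ l z} ≤
      ENNReal.ofReal (Real.exp ((C n).card * Real.log (M l) - n * a)) :=
    (eventually_all_finset L).2 fun l hl =>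
      eventually_map_halfSpace_le hZ_meas hZ_indep hZ_ident (hM1 l hl) (hM l hl)
  -- The `+ 1` keeps the logarithm meaningful for an empty cover.
  refine limsup_log_div_le (r := fun n => Real.log (L.card + 1) + ((C n).card * R - n * a)) ?_ ?_
  · filter_upwards [hev] with n hn
    calc P.map (partialMean x C f Z n) F
        ≤ P.map (partialMean x C f Z n) (⋃ l ∈ L, {z | a < inner ℝ l z}) := measure_mono hF
      _ ≤ ∑ l ∈ L, P.map (partialMean x C f Z n) {z | a < inner ℝ l z} :=
          measure_biUnion_finset_le _ _
      _ ≤ ∑ l ∈ L, ENNReal.ofReal (Real.exp ((C n).card * R - n * a)) := by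
          refine Finset.sum_le_sum fun l hl => (hn l hl).trans
            (ENNReal.ofReal_le_ofReal (Real.exp_le_exp.2 ?_))
          have := mul_le_mul_of_nonneg_left (hMR l hl) (Nat.cast_nonneg (α := ℝ) (C n).card)
          linarith
      _ ≤ _ := by
          rw [Finset.sum_const, nsmul_eq_mul, Real.exp_add, Real.exp_log (by positivity),
            ENNReal.ofReal_mul (by positivity), ← ENNReal.ofReal_natCast]
          exact mul_le_mul_left (ENNReal.ofReal_le_ofReal (by linarith)) _
  · have h1 : Tendsto (fun n : ℕ => Real.log (L.card + 1) / (n : ℝ)) atTop (𝓝 0) :=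
      tendsto_const_div_atTop_nhds_zero_nat _
    have h2 := (h1.add ((hC_card.mul_const R).sub_const a))
    rw [zero_mul, zero_sub, zero_add] at h2
    refine h2.congr' ?_
    filter_upwards [eventually_ne_atTop 0] with n hn
    have : (n : ℝ) ≠ 0 := by positivity
    field_simp

/-- Half-spaces with normals in the shrunken set cover `F` inside a box by compactness; `2 * m`
coordinate half-spaces cover the rest, which is exponential tightness. -/
theorem upper_bound (hZ_meas : ∀ i, Measurable (Z i))
    (hZ_indep : iIndepFun Z P) (hZ_ident : ∀ i, IdentDistrib (Z i) (Z 1) P P)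
    (hC_card : Tendsto (fun n : ℕ => ((C n).card : ℝ) / (n : ℝ)) atTop (𝓝 0))
    {D : Set (EuclideanSpace ℝ (Fin m))} {r : ℝ} (hr : 0 < r) (hDr : Metric.closedBall 0 r ⊆ D)
    (hD : ∀ l ∈ D, ∀ t : ℝ, 0 ≤ t → t < 1 → ∃ M : ℝ, 1 ≤ M ∧ ∀ᶠ n in atTop,
      ∀ y ∈ imageSet x C f n,
        laplace P (Z 1) (matVec y.transpose (t • l)) ≤ ENNReal.ofReal M)
    {F : Set (EuclideanSpace ℝ (Fin m))} (hF : IsClosed F) :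
    limsup (fun n : ℕ => ENNReal.log (P.map (partialMean x C f Z n) F) / (n : EReal)) atTop ≤
      -(⨅ z ∈ F, supportFun D z) := by
  by_contra! hcon
  rw [EReal.neg_lt_comm] at hcon
  obtain ⟨a, ha1, ha2⟩ := EReal.lt_iff_exists_real_btwn.1 hcon
  rw [EReal.neg_lt_comm] at ha1
  refine absurd ha1 (not_lt.2 ?_)
  rw [← EReal.coe_neg]
  classical
  set Λ : Set (EuclideanSpace ℝ (Fin m)) := {l | ∃ t : ℝ, 0 ≤ t ∧ t < 1 ∧ ∃ l' ∈ D, l = t • l'}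
  -- Chosen so that `z j > c` is exactly `⟨(r / 2) • e j, z⟩ > a`. For negative `a` the box may be
  -- empty, which is harmless.
  set c : ℝ := 2 * a / r with hc
  set B : Set (EuclideanSpace ℝ (Fin m)) :=
    WithLp.toLp 2 '' Set.Icc (fun _ => -c) (fun _ => c) with hB
  have hBc : IsCompact B := isCompact_Icc.image (PiLp.continuous_toLp 2 _)
  have hcov : F ∩ B ⊆ ⋃ l : Λ, {z | a < inner ℝ (l : EuclideanSpace ℝ (Fin m)) z} := by
    rintro z ⟨hz, -⟩
    have h1 : (a : EReal) < supportFun D z := ha2.trans_le (iInf₂_le z hz)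
    rw [← not_le, supportFun_le_coe] at h1
    push Not at h1
    obtain ⟨l', hl', hlt⟩ := h1
    -- The strict inequality survives replacing `l'` by `t • l'` with `t` close to `1`, where the
    -- transforms are controlled.
    have hcont : Tendsto (fun t : ℝ => t * inner ℝ z l') (𝓝[<] 1) (𝓝 (1 * inner ℝ z l')) :=
      ((continuous_id.mul continuous_const).tendsto 1).mono_left nhdsWithin_le_nhds
    rw [one_mul] at hcont
    obtain ⟨t, ht, ht0, ht1⟩ := ((hcont.eventually (lt_mem_nhds hlt)).and
      (Ico_mem_nhdsLT (zero_lt_one' ℝ))).exists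
    refine Set.mem_iUnion.2 ⟨⟨t • l', t, ht0, ht1, l', hl', rfl⟩, ?_⟩
    rwa [Set.mem_ofPred_eq, real_inner_smul_left, real_inner_comm]
  obtain ⟨L₁, hL₁⟩ := (hBc.inter_left hF).elim_finite_subcover _
    (fun l => isOpen_halfSpace _ a) hcov
  set e : Fin m → EuclideanSpace ℝ (Fin m) := fun j => EuclideanSpace.single j (1 : ℝ) with he
  have heD : ∀ (j : Fin m) (s : ℝ), |s| ≤ r → s • e j ∈ D := fun j s hs => hDr (by
    rw [mem_closedBall_zero_iff, norm_smul, he]; simpa using hs)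
  refine limsup_le_of_subset_halfSpaces hZ_meas hZ_indep hZ_ident hC_card
    (L := L₁.image Subtype.val ∪ (Finset.univ.image (fun j => (r / 2) • e j) ∪
      Finset.univ.image (fun j => (-(r / 2)) • e j))) ?_ ?_
  · intro l hl
    simp only [Finset.mem_union, Finset.mem_image, Finset.mem_univ, true_and] at hl
    rcases hl with ⟨l, -, rfl⟩ | ⟨j, rfl⟩ | ⟨j, rfl⟩
    · obtain ⟨t, ht, ht1, l', hl', h⟩ := l.2
      rw [h]
      exact hD l' hl' t ht ht1
    -- The normal `(r / 2) • e j` is half of a point of the ball, so `t = 1 / 2` applies.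
    · have := hD _ (heD j r (abs_of_pos hr).le) (1 / 2) (by norm_num) (by norm_num)
      rwa [smul_smul, show 1 / 2 * r = r / 2 by ring] at this
    · have := hD _ (heD j (-r) (by rw [abs_neg, abs_of_pos hr])) (1 / 2) (by norm_num)
        (by norm_num)
      rwa [smul_smul, show 1 / 2 * -r = -(r / 2) by ring] at this
  · intro z hz
    by_cases hzB : z ∈ B
    · obtain ⟨l, hl, hlz⟩ := Set.mem_iUnion₂.1 (hL₁ ⟨hz, hzB⟩)
      exact Set.mem_iUnion₂.2 ⟨l, Finset.mem_union_left _ (Finset.mem_image_of_mem _ hl), hlz⟩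
    · have : ∃ j, c < z j ∨ c < -z j := by
        by_contra! hno
        exact hzB ⟨z.ofLp, ⟨fun j => by have := (hno j).2; simp only; linarith,
          fun j => (hno j).1⟩, rfl⟩
      obtain ⟨j, hj⟩ := this
      rw [hc, div_lt_iff₀ hr, div_lt_iff₀ hr] at hj
      rcases hj with hj | hj
      · refine Set.mem_iUnion₂.2 ⟨(r / 2) • e j, by simp, ?_⟩
        rw [Set.mem_ofPred_eq, real_inner_smul_left, he]
        simp only [EuclideanSpace.inner_single_left, map_one, one_mul]
        linarith
      · refine Set.mem_iUnion₂.2 ⟨(-(r / 2)) • e j, by simp, ?_⟩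
        rw [Set.mem_ofPred_eq, real_inner_smul_left, he]
        simp only [EuclideanSpace.inner_single_left, map_one, one_mul]
        linarith

end Upper

end OutlierLDP
namespace OutlierLDP

/-! ### Lower bound -/

section Lower

variable {Ω : Type*} {m d : ℕ}
  {Z : ℕ → Ω → EuclideanSpace ℝ (Fin d)} {X : Type*} {f : X → Matrix (Fin m) (Fin d) ℝ}
  {x : ℕ → ℕ → X} {C : ℕ → Finset ℕ}

/-- Three errors: the selected particles miss their targets, their coefficients differ from `y`, and
the remaining bounded particles contribute `O(card (C n) / n)`. -/
theorem norm_partialMean_sub_le {n : ℕ} {B η R : ℝ} (hB0 : 0 ≤ B)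
    (hB : ∀ i ∈ C n, ∀ z, ‖matVec (f (x n i)) z‖ ≤ B * ‖z‖)
    {S : Finset (Matrix (Fin m) (Fin d) ℝ)}
    {w : Matrix (Fin m) (Fin d) ℝ → EuclideanSpace ℝ (Fin d)}
    {ι : Matrix (Fin m) (Fin d) ℝ → ℕ} (hι : ∀ y ∈ S, ι y ∈ C n) (hinj : Set.InjOn ι S) {ω : Ω}
    (h1 : ∀ y ∈ S, ‖(1 / (n : ℝ)) • Z (ι y) ω - w y‖ < η)
    (h2 : ∀ i ∈ C n, i ∉ S.image ι → ‖Z i ω‖ ≤ R) :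
    ‖partialMean x C f Z n ω - ∑ y ∈ S, matVec y (w y)‖ ≤
      S.card * (B * η) + ∑ y ∈ S, ‖matVec (f (x n (ι y))) (w y) - matVec y (w y)‖ +
        (C n).card / (n : ℝ) * (B * |R|) := by
  have himg : S.image ι ⊆ C n := Finset.image_subset_iff.2 hι
  have e : partialMean x C f Z n ω - ∑ y ∈ S, matVec y (w y) =
      ∑ y ∈ S, matVec (f (x n (ι y))) ((1 / (n : ℝ)) • Z (ι y) ω - w y) +
      ∑ y ∈ S, (matVec (f (x n (ι y))) (w y) - matVec y (w y)) +
      ∑ i ∈ C n \ S.image ι, (1 / (n : ℝ)) • matVec (f (x n i)) (Z i ω) := by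
    rw [partialMean, Finset.smul_sum, ← Finset.sum_sdiff himg, Finset.sum_image hinj,
      ← Finset.sum_add_distrib, add_comm, add_sub_right_comm, ← Finset.sum_sub_distrib]
    congr 1
    refine Finset.sum_congr rfl fun y _ => ?_
    have := matVec_add (f (x n (ι y))) ((1 / (n : ℝ)) • Z (ι y) ω - w y) (w y)
    rw [sub_add_cancel, matVec_smul] at this
    rw [this]
    abel
  rw [e]
  refine (norm_add₃_le).trans (add_le_add (add_le_add ?_ (norm_sum_le _ _)) ?_)
  · refine (norm_sum_le _ _).trans ((Finset.sum_le_card_nsmul _ _ (B * η) fun y hy => ?_).trans_eq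
      (nsmul_eq_mul _ _))
    exact (hB _ (hι y hy) _).trans (mul_le_mul_of_nonneg_left (h1 y hy).le hB0)
  · have h3 : ∀ i ∈ C n \ S.image ι, ‖(1 / (n : ℝ)) • matVec (f (x n i)) (Z i ω)‖ ≤
        1 / (n : ℝ) * (B * |R|) := by
      intro i hi
      rw [Finset.mem_sdiff] at hi
      rw [norm_smul, Real.norm_of_nonneg (by positivity)]
      exact mul_le_mul_of_nonneg_left ((hB i hi.1 _).trans (mul_le_mul_of_nonneg_left
        ((h2 i hi.1 hi.2).trans (le_abs_self R)) hB0)) (by positivity)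
    refine (norm_sum_le _ _).trans ((Finset.sum_le_card_nsmul _ _ _ h3).trans ?_)
    rw [nsmul_eq_mul, ← mul_assoc, mul_one_div]
    have : ((C n \ S.image ι).card : ℝ) ≤ (C n).card := by
      exact_mod_cast Finset.card_le_card Finset.sdiff_subset
    gcongr

variable [MeasurableSpace Ω] {P : Measure Ω}

/-- The event contains an intersection of one event per index, so its probability is bounded below
by a product: `exp (-n * s y)` per selected particle, `exp (-L)` per other one. -/
theorem exp_le_measure_of_independent
    (hZ_indep : iIndepFun Z P) (hZ_ident : ∀ i, IdentDistrib (Z i) (Z 1) P P)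
    {n : ℕ} {L η R : ℝ} (hL : 0 ≤ L)
    (hR : ENNReal.ofReal (Real.exp (-L)) ≤ P {ω | ‖Z 1 ω‖ ≤ R})
    {S : Finset (Matrix (Fin m) (Fin d) ℝ)}
    {w : Matrix (Fin m) (Fin d) ℝ → EuclideanSpace ℝ (Fin d)} {s : Matrix (Fin m) (Fin d) ℝ → ℝ}
    {ι : Matrix (Fin m) (Fin d) ℝ → ℕ} (hι : ∀ y ∈ S, ι y ∈ C n) (hinj : Set.InjOn ι S)
    (h : ∀ y ∈ S, ENNReal.ofReal (Real.exp (n * -s y)) ≤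
      P {ω | ‖(1 / (n : ℝ)) • Z 1 ω - w y‖ < η}) :
    ENNReal.ofReal (Real.exp (-((C n).card * L) - n * ∑ y ∈ S, s y)) ≤
      P {ω | (∀ y ∈ S, ‖(1 / (n : ℝ)) • Z (ι y) ω - w y‖ < η) ∧
        ∀ i ∈ C n, i ∉ S.image ι → ‖Z i ω‖ ≤ R} := by
  classical
  have himg : S.image ι ⊆ C n := Finset.image_subset_iff.2 hι
  -- Inverse of `ι` on `S`, so that each index in the image knows its target.
  set τ : ℕ → Matrix (Fin m) (Fin d) ℝ := Function.invFunOn ι S with hτ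
  have hτι : ∀ y ∈ S, τ (ι y) = y := fun y hy => hinj.leftInvOn_invFunOn hy
  set A : ℕ → Set (EuclideanSpace ℝ (Fin d)) := fun i =>
    if i ∈ S.image ι then {z | ‖(1 / (n : ℝ)) • z - w (τ i)‖ < η} else {z | ‖z‖ ≤ R} with hA
  have hA1 : ∀ i ∈ S.image ι, A i = {z | ‖(1 / (n : ℝ)) • z - w (τ i)‖ < η} :=
    fun i hi => if_pos hi
  have hA2 : ∀ i ∉ S.image ι, A i = {z | ‖z‖ ≤ R} := fun i hi => if_neg hi
  have hAm : ∀ i, MeasurableSet (A i) := by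
    intro i
    by_cases hi : i ∈ S.image ι
    · rw [hA1 i hi]
      exact (isOpen_lt (by fun_prop) continuous_const).measurableSet
    · rw [hA2 i hi]
      exact (isClosed_le continuous_norm continuous_const).measurableSet
  have hsub : (⋂ i ∈ C n, Z i ⁻¹' A i) ⊆ {ω | (∀ y ∈ S, ‖(1 / (n : ℝ)) • Z (ι y) ω - w y‖ < η) ∧
      ∀ i ∈ C n, i ∉ S.image ι → ‖Z i ω‖ ≤ R} := by
    intro ω hω
    rw [Set.mem_iInter₂] at hω
    refine ⟨fun y hy => ?_, fun i hi hi' => ?_⟩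
    · have := hω _ (hι y hy)
      rw [hA1 _ (Finset.mem_image_of_mem ι hy), hτι y hy] at this
      exact this
    · have := hω i hi
      rw [hA2 i hi'] at this
      exact this
  refine le_trans ?_ (measure_mono hsub)
  rw [hZ_indep.measure_inter_preimage_eq_mul (C n) fun i _ => hAm i,
    Finset.prod_congr rfl fun i _ => (hZ_ident i).measure_mem_eq (hAm i),
    ← Finset.prod_sdiff himg, Finset.prod_image hinj, sub_eq_add_neg, Real.exp_add,
    ENNReal.ofReal_mul (Real.exp_pos _).le]
  refine mul_le_mul' ?_ ?_
  · have h1 : ∏ i ∈ C n \ S.image ι, ENNReal.ofReal (Real.exp (-L)) ≤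
        ∏ i ∈ C n \ S.image ι, P (Z 1 ⁻¹' A i) := by
      refine Finset.prod_le_prod' fun i hi => ?_
      rw [hA2 i (Finset.mem_sdiff.1 hi).2]
      exact hR
    refine le_trans ?_ h1
    rw [Finset.prod_const, ← ENNReal.ofReal_pow (Real.exp_pos _).le, ← Real.exp_nat_mul]
    refine ENNReal.ofReal_le_ofReal (Real.exp_le_exp.2 ?_)
    have : ((C n \ S.image ι).card : ℝ) ≤ (C n).card := by
      exact_mod_cast Finset.card_le_card Finset.sdiff_subset
    nlinarith
  · rw [Finset.mul_sum, ← Finset.sum_neg_distrib, Real.exp_sum,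
      ENNReal.ofReal_prod_of_nonneg fun _ _ => (Real.exp_pos _).le]
    refine Finset.prod_le_prod' fun y hy => ?_
    rw [hA1 _ (Finset.mem_image_of_mem ι hy), hτι y hy, ← mul_neg]
    exact h y hy

/-- Some ball has positive mass; `L` is the finite cost of keeping one particle in it. -/
theorem exists_exp_le_measure_norm_le [IsProbabilityMeasure P]
    {Y : Ω → EuclideanSpace ℝ (Fin d)} :
    ∃ R L : ℝ, 0 ≤ L ∧ ENNReal.ofReal (Real.exp (-L)) ≤ P {ω | ‖Y ω‖ ≤ R} := by
  have hex : ∃ n : ℕ, P {ω | ‖Y ω‖ ≤ n} ≠ 0 := by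
    by_contra! h
    have := measure_iUnion_null h
    rw [show (⋃ n : ℕ, {ω | ‖Y ω‖ ≤ n}) = Set.univ from
      Set.eq_univ_of_forall fun ω => Set.mem_iUnion.2 (exists_nat_ge ‖Y ω‖), measure_univ] at this
    exact one_ne_zero this
  obtain ⟨n, hn⟩ := hex
  have hpos : 0 < P.real {ω | ‖Y ω‖ ≤ n} := ENNReal.toReal_pos hn (measure_ne_top _ _)
  refine ⟨n, -Real.log (P.real {ω | ‖Y ω‖ ≤ n}), ?_, ?_⟩
  · exact neg_nonneg.2 (Real.log_nonpos hpos.le measureReal_le_one)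
  · rw [neg_neg, Real.exp_log hpos, ofReal_measureReal]

theorem exists_index_tendsto {y : Matrix (Fin m) (Fin d) ℝ}
    (hy : y ∈ innerLimit (imageSet x C f)) :
    ∃ ι : ℕ → ℕ, (∀ᶠ n in atTop, ι n ∈ C n) ∧
      Tendsto (fun n => f (x n (ι n))) atTop (𝓝 y) := by
  obtain ⟨n₀, u, hu, hlim⟩ := hy
  have : ∀ n, ∃ i, n₀ ≤ n → i ∈ C n ∧ f (x n i) = u n := by
    intro n
    by_cases h : n₀ ≤ n
    · obtain ⟨i, hi, hi'⟩ := hu n h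
      exact ⟨i, fun _ => ⟨hi, hi'⟩⟩
    · exact ⟨0, fun h' => absurd h' h⟩
  choose ι hι using this
  refine ⟨ι, (eventually_ge_atTop n₀).mono fun n hn => (hι n hn).1, hlim.congr' ?_⟩
  exact (eventually_ge_atTop n₀).mono fun n hn => (hι n hn).2.symm

/-- Near `∑ y · w y`, where `y` ranges over finitely many elements of the inner limit, the
exponential decay rate is at most the sum of the rates of single particles near `w y`. -/
theorem le_liminf_of_decomposition [IsProbabilityMeasure P] (hZ_meas : ∀ i, Measurable (Z i))
    (hZ_indep : iIndepFun Z P) (hZ_ident : ∀ i, IdentDistrib (Z i) (Z 1) P P)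
    (hC_card : Tendsto (fun n : ℕ => ((C n).card : ℝ) / (n : ℝ)) atTop (𝓝 0))
    (hD : CompactAssumption (imageSet x C f)) {S : Finset (Matrix (Fin m) (Fin d) ℝ)}
    {w : Matrix (Fin m) (Fin d) ℝ → EuclideanSpace ℝ (Fin d)} {s : Matrix (Fin m) (Fin d) ℝ → ℝ}
    (hS : (S : Set _) ⊆ innerLimit (imageSet x C f))
    (h : ∀ y ∈ S, ∀ η > 0, ∀ᶠ n : ℕ in atTop, ENNReal.ofReal (Real.exp (n * -s y)) ≤
      P {ω | ‖(1 / (n : ℝ)) • Z 1 ω - w y‖ < η})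
    {G : Set (EuclideanSpace ℝ (Fin m))} (hG : IsOpen G) (hGz : ∑ y ∈ S, matVec y (w y) ∈ G) :
    ((-∑ y ∈ S, s y : ℝ) : EReal) ≤
      liminf (fun n : ℕ => ENNReal.log (P.map (partialMean x C f Z n) G) / (n : EReal)) atTop := by
  obtain ⟨ε, hε, hball⟩ := Metric.isOpen_iff.1 hG _ hGz
  obtain ⟨K, hK, hDK⟩ := hD.2
  obtain ⟨B, hB0, hB⟩ := exists_bound_matVec hK
  obtain ⟨R, L, hL, hR⟩ := exists_exp_le_measure_norm_le (P := P) (Y := Z 1)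
  have hidx : ∀ y ∈ S, ∃ ι : ℕ → ℕ, (∀ᶠ n in atTop, ι n ∈ C n) ∧
      Tendsto (fun n => f (x n (ι n))) atTop (𝓝 y) := fun y hy => exists_index_tendsto (hS hy)
  choose! ι hιC hιlim using hidx
  -- Makes the first of the three errors smaller than `ε / 3`.
  set η : ℝ := ε / (3 * B * (S.card + 1)) with hη
  have hη0 : 0 < η := by positivity
  have hη1 : S.card * (B * η) < ε / 3 := by
    rw [hη]
    field_simp
    linarith
  -- Distinct `y` have disjoint neighbourhoods, so they eventually use distinct, hence independent,
  -- particles.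
  have hinj : ∀ᶠ n in atTop, ∀ y ∈ S, ∀ y' ∈ S, y ≠ y' → ι y n ≠ ι y' n := by
    refine (eventually_all_finset S).2 fun y hy => (eventually_all_finset S).2 fun y' hy' => ?_
    by_cases hyy : y = y'
    · simp [hyy]
    · obtain ⟨U, V, hU, hV, hyU, hyV, hUV⟩ := t2_separation hyy
      filter_upwards [(hιlim y hy).eventually_mem (hU.mem_nhds hyU),
        (hιlim y' hy').eventually_mem (hV.mem_nhds hyV)] with n hnU hnV _ heq
      rw [← heq] at hnV
      exact Set.disjoint_left.1 hUV hnU hnV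
  have hlim : Tendsto (fun n => ∑ y ∈ S, ‖matVec (f (x n (ι y n))) (w y) - matVec y (w y)‖) atTop
      (𝓝 0) := by
    rw [← Finset.sum_const_zero (s := S)]
    refine tendsto_finsetSum _ fun y hy => tendsto_iff_norm_sub_tendsto_zero.1 ?_
    have hc : Continuous fun y' : Matrix (Fin m) (Fin d) ℝ => matVec y' (w y) :=
      continuous_matVec.comp (Continuous.prodMk_left _)
    exact (hc.tendsto y).comp (hιlim y hy)
  have hcard : Tendsto (fun n : ℕ => ((C n).card : ℝ) / (n : ℝ) * (B * |R|)) atTop (𝓝 0) := by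
    simpa using hC_card.mul_const (B * |R|)
  refine le_liminf_log_div (r := fun n => -((C n).card * L) - n * ∑ y ∈ S, s y) ?_ ?_
  · filter_upwards [hinj, hlim.eventually (gt_mem_nhds (show 0 < ε / 3 by positivity)),
      hcard.eventually (gt_mem_nhds (show 0 < ε / 3 by positivity)),
      (eventually_all_finset S).2 hιC, (eventually_all_finset S).2 fun y hy => h y hy η hη0,
      eventually_ge_atTop 1] with n hn1 hn2 hn3 hn4 hn5 hn6
    have hinj' : Set.InjOn (fun y => ι y n) S := fun y hy y' hy' heq => by
      by_contra hne
      exact hn1 y hy y' hy' hne heq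
    refine (exp_le_measure_of_independent hZ_indep hZ_ident hL hR hn4 hinj' hn5).trans ?_
    rw [Measure.map_apply (measurable_partialMean hZ_meas n) hG.measurableSet]
    refine measure_mono fun ω hω => hball ?_
    rw [mem_ball_iff_norm]
    have := norm_partialMean_sub_le hB0.le
      (fun i hi z => hB _ (hDK n hn6 ⟨i, hi, rfl⟩) z) hn4 hinj' hω.1 hω.2
    linarith
  · have h2 := (hC_card.mul_const L).neg.sub_const (∑ y ∈ S, s y)
    rw [zero_mul, neg_zero, zero_sub] at h2
    refine h2.congr' ?_
    filter_upwards [eventually_ne_atTop 0] with n hn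
    have : (n : ℝ) ≠ 0 := by positivity
    field_simp

end Lower

end OutlierLDP
namespace OutlierLDP

/-! ### The rate function and the main theorem -/

section Main

variable {Ω : Type*} [MeasurableSpace Ω] {P : Measure Ω} {m d : ℕ}

theorem outerLimit_subset_of_isClosed {M : Type*} [TopologicalSpace M] {D : ℕ → Set M}
    {K : Set M} (hK : IsClosed K) (hD : ∀ n, 1 ≤ n → D n ⊆ K) : outerLimit D ⊆ K := by
  rintro y ⟨φ, hφ, u, hu, hlim⟩
  refine hK.mem_of_tendsto hlim ((eventually_ge_atTop 1).mono fun n hn => ?_)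
  exact hD _ (hn.trans (hφ.id_le n)) (hu n)

/-- All limit matrices stay in the compact set, so `‖yᵀ l‖ ≤ B * ‖l‖ ≤ α` uniformly and the
exponential moment applies. -/
theorem exists_closedBall_subset_iInter_matDomain {Y : Ω → EuclideanSpace ℝ (Fin d)} {α : ℝ}
    (hα0 : 0 < α) (hα : ∫⁻ ω, ENNReal.ofReal (Real.exp (α * ‖Y ω‖)) ∂P < ⊤)
    {D : ℕ → Set (Matrix (Fin m) (Fin d) ℝ)} (hD : CompactAssumption D) :
    ∃ r : ℝ, 0 < r ∧ Metric.closedBall 0 r ⊆ ⋂ y ∈ outerLimit D, matDomain P Y y := by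
  obtain ⟨K, hK, hDK⟩ := hD.2
  obtain ⟨B, hB0, hB⟩ := exists_bound_matVec (isCompact_transpose hK)
  refine ⟨α / B, by positivity, fun l hl => Set.mem_iInter₂.2 fun y hy => mem_matDomain.2 ?_⟩
  rw [mem_closedBall_zero_iff, le_div_iff₀ hB0] at hl
  refine mem_logLaplaceDomain_of_norm_le hα ((hB _ ⟨y, ?_, rfl⟩ l).trans (by linarith))
  exact outerLimit_subset_of_isClosed hK.isClosed hDK hy

theorem eventually_exp_le_of_satisfiesLDP {Y : Ω → EuclideanSpace ℝ (Fin d)} (hY : Measurable Y)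
    {I : EuclideanSpace ℝ (Fin d) → EReal}
    (hI : SatisfiesLDP (fun n : ℕ => P.map (fun ω => (1 / (n : ℝ)) • Y ω)) I)
    {w : EuclideanSpace ℝ (Fin d)} {s : ℝ} (hw : I w < (s : EReal)) {η : ℝ} (hη : 0 < η) :
    ∀ᶠ n : ℕ in atTop, ENNReal.ofReal (Real.exp (n * -s)) ≤
      P {ω | ‖(1 / (n : ℝ)) • Y ω - w‖ < η} := by
  have h1 : ((-s : ℝ) : EReal) < -(⨅ z ∈ Metric.ball w η, I z) := by
    rw [EReal.coe_neg, EReal.neg_lt_neg_iff]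
    exact (iInf₂_le w (Metric.mem_ball_self hη)).trans_lt hw
  filter_upwards [eventually_exp_le_of_lt_liminf
    (h1.trans_le (hI.lower _ Metric.isOpen_ball))] with n hn
  have hm : Measurable fun ω => (1 / (n : ℝ)) • Y ω := hY.const_smul (1 / (n : ℝ))
  rw [Measure.map_apply hm Metric.isOpen_ball.measurableSet] at hn
  refine hn.trans (measure_mono fun ω hω => ?_)
  simpa [dist_eq_norm] using hω

variable {Z : ℕ → Ω → EuclideanSpace ℝ (Fin d)} {X : Type*} {f : X → Matrix (Fin m) (Fin d) ℝ}
  {x : ℕ → ℕ → X} {C : ℕ → Finset ℕ}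

theorem lower_bound [IsProbabilityMeasure P] (hZ_meas : ∀ i, Measurable (Z i))
    (hZ_indep : iIndepFun Z P) (hZ_ident : ∀ i, IdentDistrib (Z i) (Z 1) P P)
    {I : EuclideanSpace ℝ (Fin d) → EReal} (hA1 : ParticleLDP P (Z 1) I)
    (hA2 : ∀ z, I z = supportFun (logLaplaceDomain P (Z 1)) z)
    (hC_card : Tendsto (fun n : ℕ => ((C n).card : ℝ) / (n : ℝ)) atTop (𝓝 0))
    (hD : CompactAssumption (imageSet x C f))
    {G : Set (EuclideanSpace ℝ (Fin m))} (hG : IsOpen G) :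
    -(⨅ z ∈ G, supportFun (⋂ y ∈ innerLimit (imageSet x C f), matDomain P (Z 1) y) z) ≤
      liminf (fun n : ℕ => ENNReal.log (P.map (partialMean x C f Z n) G) / (n : EReal)) atTop := by
  obtain ⟨α, hα0, hα⟩ := hA1.expMoment
  rw [EReal.neg_le]
  refine le_iInf₂ fun z hz => EReal.le_of_forall_lt_iff_le.1 fun j hj => ?_
  rw [EReal.neg_le]
  refine EReal.ge_of_forall_gt_iff_ge.1 fun b hb => ?_
  rw [← EReal.coe_neg, EReal.coe_lt_coe_iff] at hb
  obtain ⟨ε, hε, hball⟩ := Metric.isOpen_iff.1 hG z hz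
  -- The gap between `b` and `-j` is split in two: half for the approximate decomposition, half for
  -- making each one-particle cost strict.
  set δ : ℝ := min ε ((-j - b) / 2) with hδ
  have hδ0 : 0 < δ := lt_min hε (by linarith)
  obtain ⟨S, w, s, hS, hws, hSz, hSs⟩ :=
    exists_approx_decomposition (hZ_meas 1) hα0 hα hj.le hδ0
  have hSs' : ∑ y ∈ S, (s y + δ / (S.card + 1)) ≤ -b := by
    rw [Finset.sum_add_distrib, Finset.sum_const, nsmul_eq_mul]
    have h1 : S.card * (δ / (S.card + 1)) ≤ δ := by
      rw [mul_div_assoc', div_le_iff₀ (by positivity)]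
      nlinarith
    have h2 : δ ≤ (-j - b) / 2 := min_le_right _ _
    linarith
  refine le_trans ?_ (le_liminf_of_decomposition hZ_meas hZ_indep hZ_ident hC_card hD hS
    (s := fun y => s y + δ / (S.card + 1)) (fun y _ η hη => ?_) hG
    (hball (mem_ball_iff_norm.2 (hSz.trans_le (min_le_left _ _)))))
  · exact EReal.coe_le_coe_iff.2 (by linarith)
  · refine eventually_exp_le_of_satisfiesLDP (hZ_meas 1) hA1.ldp ?_ hη
    rw [hA2]
    -- The share `δ / (S.card + 1)` gives the strict inequality needed by the one-particle lower
    -- bound.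
    refine (supportFun_le_coe.2 (hws y)).trans_lt (EReal.coe_lt_coe_iff.2 ?_)
    have : 0 < δ / (S.card + 1) := by positivity
    linarith

end Main

end OutlierLDP

theorem theorem2p2 {Ω : Type*} [MeasurableSpace Ω] (P : Measure Ω) [IsProbabilityMeasure P]
    {X : Type*} [MetricSpace X] {m d : ℕ}
    (Z : ℕ → Ω → EuclideanSpace ℝ (Fin d))
    (hZ_meas : ∀ i, Measurable (Z i))
    (hZ_indep : iIndepFun Z P)
    (hZ_ident : ∀ i, IdentDistrib (Z i) (Z 1) P P)
    (I : EuclideanSpace ℝ (Fin d) → EReal)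
    (hA1 : OutlierLDP.ParticleLDP P (Z 1) I)
    (hA2 : ∀ z, I z = OutlierLDP.supportFun (OutlierLDP.logLaplaceDomain P (Z 1)) z)
    (f : X → Matrix (Fin m) (Fin d) ℝ) (hf : Continuous f)
    (x : ℕ → ℕ → X) (C : ℕ → Finset ℕ)
    (hC_sub : ∀ n, C n ⊆ Finset.Icc 1 n)
    (hC_card : Tendsto (fun n : ℕ => ((C n).card : ℝ) / (n : ℝ)) atTop (𝓝 0))
    (hA3 : OutlierLDP.CompactAssumption (OutlierLDP.imageSet x C f))
    (hA4 : OutlierLDP.LimitPointAssumption P (Z 1) (OutlierLDP.imageSet x C f)) :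
    ∃ D : Set (EuclideanSpace ℝ (Fin m)),
      D = (⋂ y ∈ OutlierLDP.innerLimit (OutlierLDP.imageSet x C f),
        OutlierLDP.matDomain P (Z 1) y) ∧
      D = (⋂ y ∈ OutlierLDP.outerLimit (OutlierLDP.imageSet x C f),
        OutlierLDP.matDomain P (Z 1) y) ∧
      OutlierLDP.IsGoodRateFunction (OutlierLDP.supportFun D) ∧
      OutlierLDP.SatisfiesLDP
        (fun n : ℕ => P.map (OutlierLDP.partialMean x C f Z n)) (OutlierLDP.supportFun D) := by
  obtain ⟨α, hα0, hα⟩ := hA1.expMoment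
  obtain ⟨r, hr, hball⟩ :=
    OutlierLDP.exists_closedBall_subset_iInter_matDomain (P := P) (Y := Z 1) hα0 hα hA3
  refine ⟨_, rfl, hA4, ?_, ?_, ?_⟩
  -- The intersection over the inner limit is exchanged for that over the outer limit, where the
  -- ball was found.
  · rw [show _ = _ from hA4]
    exact OutlierLDP.isGoodRateFunction_supportFun hr hball
  · intro F hF
    rw [show _ = _ from hA4]
    exact OutlierLDP.upper_bound hZ_meas hZ_indep hZ_ident hC_card hr hball
      (fun l hl t ht ht1 =>
        OutlierLDP.eventually_laplace_le (hZ_meas 1) hα0 hα hA3 hl ht ht1) hF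
  · intro G hG
    exact OutlierLDP.lower_bound hZ_meas hZ_indep hZ_ident hA1 hA2 hC_card hA3 hG
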